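/- Work on $([0,\infty),\lambda)$ with Lebesgue measure $\lambda$. Let $M$ be the set of (a.e. classes of) extended complex-valued measurable functions on $[0,\infty)$ and $M_+$ its subset of functions with values in $[0,\infty]$. For $f\in M$ let $\lambda_f(s)=\lambda(\{|f|>s\})$, $s\ge 0$, be its distribution function and $f^*(t)=\inf\{s\in[0,\infty):\lambda_f(s)\le t\}$, $t\ge 0$, its non-increasing rearrangement. A functional $\|\cdot\|:M\to[0,\infty]$ with $\|f\|=\||f|\|$ is a quasi-Banach function norm if on $M_+$ - (Q1) $\|af\|=|a|\,\|f\|$ for $a\in\mathbb C$; $\|f\|=0$ iff $f=0$ a.e.; and for some constant $C\ge1$, $\|f+g\|\le C(\|f\|+\|g\|)$ for all $f,g$; - (P2) $f\le g$ a.e. implies $\|f\|\le\|g\|$; - (P3) $f_n\uparrow f$ a.e. implies $\|f_n\|\uparrow\|f\|$; - (P4) $\|\chi_E\|<\infty$ whenever $\lambda(E)<\infty$. It is rearrangement-invariant (r.i.) if $\|f\|=\|g\|$ whenever $\lambda_f=\lambda_g$. It has property (P1) if (Q1) holds with $C=1$, and property (P5) if for every $E$ with $\lambda(E)<\infty$ there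 is a finite constant $C_E$ with $\int_E f\,d\lambda\le C_E\|f\|$ for all $f\in M_+$. The corresponding space is $\{f\in M:\|f\|<\infty\}$ with the topology defined by the quasinorm. For r.i. quasi-Banach function norms $\|\cdot\|_A,\|\cdot\|_B$, the Wiener--Luxemburg amalgam space $WL(A,B)$ is the space of the functional $$\|f\|_{WL(A,B)}=\|f^*\chi_{[0,1]}\|_A+\|f^*\chi_{(1,\infty)}\|_B .$$ Write $Y\hookrightarrow X$ if $Y\subseteq X$ and the identity map $Y\to X$ is continuous. **Theorem.** Let $\|\cdot\|_A$ be an r.i. quasi-Banach function norm over $([0,\infty),\lambda)$ and let $A$ be the corresponding space. Then 1. $WL(L^\infty,A)\hookrightarrow A$; 2. if $\|\cdot\|_A$ has property (P1), then $WL(A,L^1)\hookrightarrow A$; 3. $A\hookrightarrow WL(L^1,A)$ if and only if $\|\cdot\|_A$ has property (P5); 4. $A\hookrightarrow WL(A,L^\infty)$. -/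

import Mathlib

open MeasureTheory Set Filter Topology
open scoped ENNReal NNReal

noncomputable section

namespace WienerLuxemburg

variable {R : Type*} [MeasurableSpace R]

/-! ### Function norms

A functional `‖·‖` on (extended complex-valued) measurable functions with `‖f‖ = ‖|f|‖` is the same
thing as its restriction to `[0, ∞]`-valued measurable functions. We therefore describe it by a map
`ρ : (R → ℝ≥0∞) → ℝ≥0∞`, of which only the values at `μ`-a.e.-measurable functions are ever
constrained or used, and put `‖f‖ = ρ |f|` for general `f`. -/

/-- (P1): the functional is a norm. Here `|a f| = |a| f` for `f ≥ 0`, so that homogeneity only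
concerns scalars `|a| ∈ [0, ∞)`; the convention `0 * ∞ = 0` is in force. -/
structure HasP1 (μ : Measure R) (ρ : (R → ℝ≥0∞) → ℝ≥0∞) : Prop where
  homogeneous : ∀ (a : ℝ≥0) (f : R → ℝ≥0∞), AEMeasurable f μ →
    ρ (fun x => (a : ℝ≥0∞) * f x) = (a : ℝ≥0∞) * ρ f
  eq_zero_iff : ∀ f : R → ℝ≥0∞, AEMeasurable f μ → (ρ f = 0 ↔ f =ᵐ[μ] 0)
  subadditive : ∀ f g : R → ℝ≥0∞, AEMeasurable f μ → AEMeasurable g μ →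
    ρ (fun x => f x + g x) ≤ ρ f + ρ g

/-- (Q1): the functional is a quasinorm. -/
structure HasQ1 (μ : Measure R) (ρ : (R → ℝ≥0∞) → ℝ≥0∞) : Prop where
  homogeneous : ∀ (a : ℝ≥0) (f : R → ℝ≥0∞), AEMeasurable f μ →
    ρ (fun x => (a : ℝ≥0∞) * f x) = (a : ℝ≥0∞) * ρ f
  eq_zero_iff : ∀ f : R → ℝ≥0∞, AEMeasurable f μ → (ρ f = 0 ↔ f =ᵐ[μ] 0)
  quasi_subadditive : ∃ C : ℝ≥0, 1 ≤ C ∧ ∀ f g : R → ℝ≥0∞, AEMeasurable f μ → AEMeasurable g μ →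
    ρ (fun x => f x + g x) ≤ C * (ρ f + ρ g)

/-- (P2): the lattice property. -/
def HasP2 (μ : Measure R) (ρ : (R → ℝ≥0∞) → ℝ≥0∞) : Prop :=
  ∀ f g : R → ℝ≥0∞, AEMeasurable f μ → AEMeasurable g μ → f ≤ᵐ[μ] g → ρ f ≤ ρ g

/-- (P3): the Fatou property, `f_n ↑ f` a.e. implies `‖f_n‖ ↑ ‖f‖`. -/
def HasP3 (μ : Measure R) (ρ : (R → ℝ≥0∞) → ℝ≥0∞) : Prop :=
  ∀ (f : ℕ → R → ℝ≥0∞) (g : R → ℝ≥0∞), (∀ n, AEMeasurable (f n) μ) → AEMeasurable g μ →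
    (∀ᵐ x ∂μ, Monotone (fun n => f n x) ∧ Tendsto (fun n => f n x) atTop (𝓝 (g x))) →
    Monotone (fun n => ρ (f n)) ∧ Tendsto (fun n => ρ (f n)) atTop (𝓝 (ρ g))

/-- (P4): characteristic functions of sets of finite measure have finite norm. -/
def HasP4 (μ : Measure R) (ρ : (R → ℝ≥0∞) → ℝ≥0∞) : Prop :=
  ∀ E : Set R, MeasurableSet E → μ E < ∞ → ρ (E.indicator fun _ => 1) < ∞

/-- (P5): functions of finite norm are integrable over sets of finite measure, with a bound. -/
def HasP5 (μ : Measure R) (ρ : (R → ℝ≥0∞) → ℝ≥0∞) : Prop :=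
  ∀ E : Set R, MeasurableSet E → μ E < ∞ → ∃ C : ℝ≥0, ∀ f : R → ℝ≥0∞, AEMeasurable f μ →
    ∫⁻ x in E, f x ∂μ ≤ C * ρ f

/-- Quasi-Banach function norms. -/
structure IsQuasiBanachFunctionNorm (μ : Measure R) (ρ : (R → ℝ≥0∞) → ℝ≥0∞) : Prop where
  q1 : HasQ1 μ ρ
  p2 : HasP2 μ ρ
  p3 : HasP3 μ ρ
  p4 : HasP4 μ ρ

/-! ### Rearrangements -/

/-- The distribution function `s ↦ μ {x | f x > s}`, `s ∈ [0, ∞)`, of a nonnegative function. -/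
def distribution (μ : Measure R) (f : R → ℝ≥0∞) (s : ℝ≥0) : ℝ≥0∞ :=
  μ {x | (s : ℝ≥0∞) < f x}

/-- The non-increasing rearrangement `f^*(t) = inf {s ∈ [0, ∞) | μ_f(s) ≤ t}`, `t ∈ [0, ∞)`; the
infimum is taken in `[0, ∞]`, so that the infimum of the empty set is `∞`. -/
def rearrangement (μ : Measure R) (f : R → ℝ≥0∞) (t : ℝ≥0) : ℝ≥0∞ :=
  ⨅ (s : ℝ≥0) (_ : distribution μ f s ≤ t), (s : ℝ≥0∞)

/-- Rearrangement-invariant quasi-Banach function norms: equimeasurable functions have the same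
norm. -/
structure IsRIQuasiBanachFunctionNorm (μ : Measure R) (ρ : (R → ℝ≥0∞) → ℝ≥0∞) : Prop extends
    IsQuasiBanachFunctionNorm μ ρ where
  rearrangement_invariant : ∀ f g : R → ℝ≥0∞, AEMeasurable f μ → AEMeasurable g μ →
    distribution μ f = distribution μ g → ρ f = ρ g

/-! ### The associated spaces and their embeddings -/

/-- The norm `‖f‖ = ρ |f|` of an a.e.-class of complex-valued measurable functions. -/
def fnorm {μ : Measure R} (ρ : (R → ℝ≥0∞) → ℝ≥0∞) (f : R →ₘ[μ] ℂ) : ℝ≥0∞ :=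
  ρ (fun x => ‖f x‖ₑ)

/-- The space `{f | ‖f‖ < ∞}` of a function norm. A function of finite (quasi-)norm is finite
almost everywhere, so its a.e.-class is a class of `ℂ`-valued functions. -/
def functionSpace (μ : Measure R) (ρ : (R → ℝ≥0∞) → ℝ≥0∞) : Set (R →ₘ[μ] ℂ) :=
  {f | fnorm ρ f < ∞}

/-- The topology that a quasinorm defines on its space: `U` is open if with each of its points it
contains a ball `{g | ‖g - f‖ < ε}`. -/
@[reducible]
def spaceTopology (μ : Measure R) (ρ : (R → ℝ≥0∞) → ℝ≥0∞) :
    TopologicalSpace (functionSpace μ ρ) where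
  IsOpen U := ∀ f ∈ U, ∃ ε : ℝ≥0, 0 < ε ∧
    ∀ g : functionSpace μ ρ, fnorm ρ (g.1 - f.1) < ε → g ∈ U
  isOpen_univ := fun _ _ => ⟨1, one_pos, fun _ _ => mem_univ _⟩
  isOpen_inter := by
    rintro U V hU hV f ⟨hfU, hfV⟩
    obtain ⟨a, ha, hU⟩ := hU f hfU
    obtain ⟨b, hb, hV⟩ := hV f hfV
    refine ⟨min a b, lt_min ha hb, fun g hg => ⟨hU g (hg.trans_le ?_), hV g (hg.trans_le ?_)⟩⟩
    · exact_mod_cast min_le_left a b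
    · exact_mod_cast min_le_right a b
  isOpen_sUnion := by
    rintro S hS f ⟨U, hUS, hfU⟩
    obtain ⟨a, ha, hU⟩ := hS U hUS f hfU
    exact ⟨a, ha, fun g hg => ⟨U, hUS, hU g hg⟩⟩

/-- `X ↪ Y` for the spaces `X`, `Y` of the functionals `ρ`, `σ`: `X ⊆ Y` and the identity map
`X → Y` is continuous. -/
def Embeds (μ : Measure R) (ρ σ : (R → ℝ≥0∞) → ℝ≥0∞) : Prop :=
  ∃ h : functionSpace μ ρ ⊆ functionSpace μ σ,
    Continuous[spaceTopology μ ρ, spaceTopology μ σ] (Set.inclusion h)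

/-! ### Lebesgue norms and Wiener--Luxemburg amalgams on `([0, ∞), λ)` -/

/-- Lebesgue measure on `[0, ∞)`. -/
def halfLine : Measure ℝ≥0 := (volume : Measure ℝ).comap (fun x : ℝ≥0 => (x : ℝ))

/-- The functional of `L^p` on `([0, ∞), λ)`. -/
def lebesgueNorm (p : ℝ≥0∞) (f : ℝ≥0 → ℝ≥0∞) : ℝ≥0∞ := eLpNorm f p halfLine

/-- The Wiener--Luxemburg functional `‖f^* χ_[0,1]‖_A + ‖f^* χ_(1,∞)‖_B`. -/
def WL (A B : (ℝ≥0 → ℝ≥0∞) → ℝ≥0∞) (f : ℝ≥0 → ℝ≥0∞) : ℝ≥0∞ :=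
  A ((Set.Icc 0 1).indicator (rearrangement halfLine f)) +
    B ((Set.Ioi 1).indicator (rearrangement halfLine f))

end WienerLuxemburg

end

open WienerLuxemburg

namespace WienerLuxemburg

/-! ### Lebesgue measure on the half-line -/

/-! Since `f` and `f^*` are equimeasurable, `A f = A f^*`, and cutting `f^*` at 1 shows that `A` is
equivalent to `WL A A`. Each embedding then compares one of the two pieces, using that `f^*`
decreases. Write `a` for the norm of the characteristic function of `[0,1]`, which is positive and
finite. The head is at most `a` times its supremum, and the tail is bounded by `f^*(1)`, where
`f^*(1) * a` is at most the norm of the head (`rearrangement_one_mul_le`). Under (P1) the tail is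
dominated by a step function with steps of unit length, and the countable triangle inequality
compares it with the integral (`indicator_Ioi_rearrangement_le`).

For the equivalence with (P5), one direction applies (P5) on `[0,1]` to `f^*`. Conversely, the
inclusion makes the integral of `f^*` over `[0,1]` finite, hence that of `f` over every set of
finite measure (`setLIntegral_le_setLIntegral_rearrangement`). Summing suitably scaled
counterexamples turns this finiteness into a uniform bound (`exists_setLIntegral_le`). -/

theorem measurableEmbedding_coe_nnreal : MeasurableEmbedding (fun x : ℝ≥0 => (x : ℝ)) :=
  MeasurableEmbedding.subtype_coe measurableSet_Ici

theorem halfLine_apply (s : Set ℝ≥0) :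
    halfLine s = (volume : Measure ℝ) ((fun x : ℝ≥0 => (x : ℝ)) '' s) :=
  measurableEmbedding_coe_nnreal.comap_apply _ _

theorem image_coe_nnreal_Ioc (a b : ℝ≥0) :
    (fun x : ℝ≥0 => (x : ℝ)) '' Ioc a b = Ioc (a : ℝ) b := by
  ext x
  constructor
  · rintro ⟨y, ⟨h1, h2⟩, rfl⟩
    exact ⟨by exact_mod_cast h1, by exact_mod_cast h2⟩
  · rintro ⟨h1, h2⟩
    exact ⟨⟨x, a.2.trans h1.le⟩, ⟨h1, h2⟩, rfl⟩

theorem halfLine_Ioc (a b : ℝ≥0) : halfLine (Ioc a b) = ((b - a : ℝ≥0) : ℝ≥0∞) := by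
  rw [halfLine_apply, image_coe_nnreal_Ioc, Real.volume_Ioc, ENNReal.ofReal, NNReal.sub_def]

theorem halfLine_singleton (a : ℝ≥0) : halfLine {a} = 0 := by
  simp [halfLine_apply]

instance : NullSingletonClass halfLine := ⟨halfLine_singleton⟩

instance : SigmaFinite halfLine := by
  refine ⟨⟨⟨fun n : ℕ => Icc 0 (n : ℝ≥0), fun _ => trivial, fun n => ?_, ?_⟩⟩⟩
  · rw [← measure_congr Ioc_ae_eq_Icc, halfLine_Ioc]
    exact ENNReal.coe_lt_top
  · refine eq_univ_of_forall fun x => mem_iUnion.2 ?_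
    obtain ⟨n, hn⟩ := exists_nat_ge x
    exact ⟨n, zero_le, hn⟩

theorem halfLine_Iio (a : ℝ≥0) : halfLine (Iio a) = a := by
  rw [← Ico_bot, measure_congr Ico_ae_eq_Ioc, halfLine_Ioc, bot_eq_zero, tsub_zero]

theorem halfLine_Icc_zero (a : ℝ≥0) : halfLine (Icc 0 a) = a := by
  rw [← measure_congr Ioc_ae_eq_Icc, halfLine_Ioc, tsub_zero]

theorem halfLine_univ : halfLine univ = ∞ := by
  refine ENNReal.eq_top_of_forall_nnreal_le fun r => ?_
  rw [← halfLine_Iio r]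
  exact measure_mono (subset_univ _)

theorem halfLine_coe_lt (c : ℝ≥0∞) : halfLine {s : ℝ≥0 | (s : ℝ≥0∞) < c} = c := by
  induction c with
  | top => simp [halfLine_univ]
  | coe c =>
    simp only [ENNReal.coe_lt_coe]
    exact halfLine_Iio c

/-! ### Distribution functions and rearrangements -/

section Rearrangement

variable {R : Type*} [MeasurableSpace R] {μ : Measure R}

theorem distribution_antitone (μ : Measure R) (f : R → ℝ≥0∞) : Antitone (distribution μ f) :=
  fun _ _ hst => measure_mono fun _ hx => lt_of_le_of_lt (ENNReal.coe_le_coe.2 hst) hx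

theorem rearrangement_antitone (μ : Measure R) (f : R → ℝ≥0∞) :
    Antitone (rearrangement μ f) := fun _ _ hst =>
  iInf_mono fun _ => iInf_mono' fun h => ⟨h.trans (ENNReal.coe_le_coe.2 hst), le_rfl⟩

theorem measurable_rearrangement (μ : Measure R) (f : R → ℝ≥0∞) :
    Measurable (rearrangement μ f) :=
  (rearrangement_antitone μ f).measurable

/-- The distribution function is right-continuous. -/
theorem distribution_le_of_forall_gt {f : R → ℝ≥0∞} {s : ℝ≥0} {c : ℝ≥0∞}
    (h : ∀ r, s < r → distribution μ f r ≤ c) : distribution μ f s ≤ c := by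
  obtain ⟨u, hu, hus, hulim⟩ := exists_seq_strictAnti_tendsto s
  have hset : {x | (s : ℝ≥0∞) < f x} = ⋃ n, {x | (u n : ℝ≥0∞) < f x} := by
    ext x
    simp only [mem_ofPred_eq, mem_iUnion]
    constructor
    · intro hx
      have := (ENNReal.tendsto_coe.2 hulim).eventually (gt_mem_nhds hx)
      exact this.exists
    · rintro ⟨n, hn⟩
      exact (ENNReal.coe_lt_coe.2 (hus n)).trans hn
  have hmono : Monotone fun n => {x | (u n : ℝ≥0∞) < f x} := fun m n hmn x hx =>
    lt_of_le_of_lt (ENNReal.coe_le_coe.2 (hu.antitone hmn)) hx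
  rw [distribution, hset, hmono.measure_iUnion]
  exact iSup_le fun n => h _ (hus n)

/-- Right-continuity of the distribution function means that the infimum defining `f^*` is attained
when finite. The superlevel sets of `f^*` are therefore initial intervals of known length. -/
theorem lt_rearrangement_iff {f : R → ℝ≥0∞} {s t : ℝ≥0} :
    (s : ℝ≥0∞) < rearrangement μ f t ↔ (t : ℝ≥0∞) < distribution μ f s := by
  rw [← not_le, ← not_le (b := (t : ℝ≥0∞)), not_iff_not]
  constructor
  · intro h
    refine distribution_le_of_forall_gt fun r hr => ?_
    have h' : rearrangement μ f t < r := h.trans_lt (ENNReal.coe_lt_coe.2 hr)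
    simp only [rearrangement, iInf_lt_iff] at h'
    obtain ⟨q, hq, hqr⟩ := h'
    exact (distribution_antitone μ f (ENNReal.coe_lt_coe.1 hqr).le).trans hq
  · exact fun h => iInf₂_le s h

theorem distribution_rearrangement (μ : Measure R) (f : R → ℝ≥0∞) :
    distribution halfLine (rearrangement μ f) = distribution μ f := by
  funext s
  simp only [distribution, lt_rearrangement_iff]
  exact halfLine_coe_lt _

theorem distribution_indicator_one (E : Set R) (s : ℝ≥0) :
    distribution μ (E.indicator fun _ => 1) s = if s < 1 then μ E else 0 := by
  unfold distribution
  split_ifs with h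
  · congr 1
    ext x
    by_cases hx : x ∈ E <;> simp [hx, h]
  · rw [← measure_empty (μ := μ)]
    congr 1
    ext x
    by_cases hx : x ∈ E <;> simp [hx, not_lt.1 h]

/-- Cavalieri's principle for functions with values in `[0, ∞]`. -/
theorem setLIntegral_eq_lintegral_measure_inter [SFinite μ] {f : R → ℝ≥0∞} (hf : Measurable f)
    (E : Set R) (hE : MeasurableSet E) :
    ∫⁻ x in E, f x ∂μ = ∫⁻ s, μ ({x | (s : ℝ≥0∞) < f x} ∩ E) ∂halfLine := by
  have hm : MeasurableSet {p : R × ℝ≥0 | (p.2 : ℝ≥0∞) < f p.1} :=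
    measurableSet_lt (by fun_prop) (by fun_prop)
  -- Tonelli for the region under the graph: the section over `x` has length `f x`, also when `f x =
  -- ∞`.
  have h1 := Measure.prod_apply (μ := μ.restrict E) (ν := halfLine) hm
  have h2 := Measure.prod_apply_symm (μ := μ.restrict E) (ν := halfLine) hm
  rw [h1] at h2
  simp only [preimage_ofPred_eq, halfLine_coe_lt] at h2
  rw [h2]
  refine lintegral_congr fun s => ?_
  rw [Measure.restrict_apply' hE]

/-- The integral of a function over a set of finite measure is controlled by the integral of its
rearrangement over the unit interval. -/
theorem setLIntegral_le_setLIntegral_rearrangement [SFinite μ] {f : R → ℝ≥0∞}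
    (hf : AEMeasurable f μ) {E : Set R} (hE : MeasurableSet E)
    (hμE : μ E ≠ ∞) :
    ∫⁻ x in E, f x ∂μ ≤ max 1 (μ E) * ∫⁻ t in Icc 0 1, rearrangement μ f t ∂halfLine := by
  have hc : distribution μ (hf.mk f) = distribution μ f := by
    funext s
    refine measure_congr ?_
    filter_upwards [hf.ae_eq_mk] with x hx
    exact congrArg (fun y => (s : ℝ≥0∞) < y) hx.symm
  rw [lintegral_congr_ae (ae_restrict_of_ae hf.ae_eq_mk),
    setLIntegral_eq_lintegral_measure_inter hf.measurable_mk E hE,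
    setLIntegral_eq_lintegral_measure_inter (measurable_rearrangement μ f) _ measurableSet_Icc,
    ← lintegral_const_mul' _ _ (max_ne_top ENNReal.one_ne_top hμE)]
  refine lintegral_mono fun s => ?_
  have h1 : μ ({x | (s : ℝ≥0∞) < hf.mk f x} ∩ E) ≤ min (distribution μ f s) (μ E) :=
    le_min (hc ▸ measure_mono inter_subset_left) (measure_mono inter_subset_right)
  have h2 : min (distribution μ f s) 1 ≤
      halfLine ({t | (s : ℝ≥0∞) < rearrangement μ f t} ∩ Icc 0 1) := by
    rw [← halfLine_coe_lt (min (distribution μ f s) 1)]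
    refine measure_mono fun t (ht : (t : ℝ≥0∞) < _) => ?_
    exact ⟨lt_rearrangement_iff.2 (ht.trans_le (min_le_left _ _)), zero_le,
      by exact_mod_cast (ht.trans_le (min_le_right _ _)).le⟩
  refine h1.trans (le_trans ?_ (mul_le_mul_right h2 _))
  -- What remains, with `d` the distribution function at `s`, is `min d (μ E) ≤ max 1 (μ E) * min d
  -- 1`.
  rcases le_total (distribution μ f s) 1 with h | h
  · rw [min_eq_left h]
    exact (min_le_left _ _).trans (le_mul_of_one_le_left' (le_max_left _ _))
  · rw [min_eq_right h, mul_one]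
    exact (min_le_right _ _).trans (le_max_right _ _)

end Rearrangement

/-! ### Quasi-Banach function norms -/

section FunctionNorm

variable {R : Type*} [MeasurableSpace R] {μ : Measure R} {ρ σ : (R → ℝ≥0∞) → ℝ≥0∞}

/-- A norm estimate implies an embedding of the corresponding spaces. -/
theorem Embeds.of_le (K : ℝ≥0)
    (h : ∀ f : R → ℝ≥0∞, AEMeasurable f μ → ρ f < ∞ → σ f ≤ K * ρ f) : Embeds μ ρ σ := by
  have hm (f : R →ₘ[μ] ℂ) : AEMeasurable (fun x => ‖f x‖ₑ) μ := f.aestronglyMeasurable.enorm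
  refine ⟨fun f hf => (h _ (hm f) hf).trans_lt (ENNReal.mul_lt_top ENNReal.coe_lt_top hf), ?_⟩
  refine (@continuous_def _ _ (spaceTopology μ ρ) (spaceTopology μ σ) _).2 fun U hU f hf => ?_
  obtain ⟨ε, hε, hball⟩ := hU _ hf
  -- The summand 1 covers `K = 0`. The estimate is applied to the difference `g - f`, so `σ` need
  -- not be subadditive.
  refine ⟨ε / (K + 1), by positivity, fun g hg => hball _ ?_⟩
  refine (h _ (hm _) (hg.trans ENNReal.coe_lt_top)).trans_lt ?_
  calc (K : ℝ≥0∞) * fnorm ρ (g.1 - f.1) ≤ K * ((ε / (K + 1) : ℝ≥0) : ℝ≥0∞) :=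
        mul_le_mul_right hg.le _
    _ < ε := by
        rw [← ENNReal.coe_mul, ENNReal.coe_lt_coe, mul_div_assoc', div_lt_iff₀ (by positivity)]
        rw [mul_comm]
        exact mul_lt_mul_of_pos_left (lt_add_one K) hε

theorem HasP2.congr (h : HasP2 μ ρ) {f g : R → ℝ≥0∞} (hf : AEMeasurable f μ)
    (hg : AEMeasurable g μ) (hfg : f =ᵐ[μ] g) : ρ f = ρ g :=
  (h f g hf hg hfg.le).antisymm (h g f hg hf hfg.symm.le)

namespace IsQuasiBanachFunctionNorm

theorem apply_zero (hρ : IsQuasiBanachFunctionNorm μ ρ) : ρ (fun _ => 0) = 0 :=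
  (hρ.q1.eq_zero_iff _ aemeasurable_const).2 (ae_eq_refl _)

/-- Homogeneity with respect to scalars in `[0, ∞]`. -/
theorem const_mul (hρ : IsQuasiBanachFunctionNorm μ ρ) (c : ℝ≥0∞) {f : R → ℝ≥0∞}
    (hf : AEMeasurable f μ) : ρ (fun x => c * f x) = c * ρ f := by
  induction c with
  | coe c => exact hρ.q1.homogeneous c f hf
  | top =>
    have key (y : ℝ≥0∞) : Tendsto (fun n : ℕ => ((n : ℝ≥0) : ℝ≥0∞) * y) atTop (𝓝 (∞ * y)) := by
      rcases eq_or_ne y 0 with rfl | hy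
      · simp
      · simpa using ENNReal.Tendsto.mul_const ENNReal.tendsto_nat_nhds_top (Or.inl ENNReal.top_ne_zero)
    have h := (hρ.p3 (fun n x => ((n : ℝ≥0) : ℝ≥0∞) * f x) (fun x => ∞ * f x)
      (fun n => hf.const_mul _) (hf.const_mul _) (.of_forall fun x => ⟨fun m n hmn =>
        mul_le_mul_left (by exact_mod_cast hmn) _, key _⟩)).2
    simp only [hρ.q1.homogeneous _ f hf] at h
    exact tendsto_nhds_unique h (key _)

/-- A function of finite quasinorm is finite almost everywhere. -/
theorem ae_lt_top (hρ : IsQuasiBanachFunctionNorm μ ρ) {f : R → ℝ≥0∞} (hf : AEMeasurable f μ)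
    (hfin : ρ f < ∞) : ∀ᵐ x ∂μ, f x < ∞ := by
  have hS : NullMeasurableSet (f ⁻¹' {∞}) μ := hf.nullMeasurable (measurableSet_singleton ∞)
  have hχ : AEMeasurable ((f ⁻¹' {∞}).indicator fun _ => (1 : ℝ≥0∞)) μ :=
    aemeasurable_const.indicator₀ hS
  -- On `{f = ∞}` the function dominates `∞` times the characteristic function, whose norm must then
  -- vanish.
  have hle : ∞ * ρ ((f ⁻¹' {∞}).indicator fun _ => 1) ≤ ρ f := by
    rw [← hρ.const_mul ∞ hχ]
    refine hρ.p2 _ _ (hχ.const_mul _) hf (.of_forall fun x => ?_)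
    by_cases hx : x ∈ f ⁻¹' {∞}
    · simp [show f x = ∞ from hx]
    · simp [indicator_of_notMem hx]
  have h0 : ρ ((f ⁻¹' {∞}).indicator fun _ => 1) = 0 := by
    by_contra hne
    rw [ENNReal.top_mul hne] at hle
    exact hle.not_gt hfin
  filter_upwards [(hρ.q1.eq_zero_iff _ hχ).1 h0] with x hx
  refine lt_top_iff_ne_top.2 fun hfx => ?_
  rw [indicator_of_mem (show x ∈ f ⁻¹' {∞} from hfx)] at hx
  exact one_ne_zero hx

/-- A countable quasi-triangle inequality. -/
theorem tsum_le (hρ : IsQuasiBanachFunctionNorm μ ρ) {C : ℝ≥0∞}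
    (hC : ∀ f g : R → ℝ≥0∞, AEMeasurable f μ → AEMeasurable g μ →
      ρ (fun x => f x + g x) ≤ C * (ρ f + ρ g))
    {f : ℕ → R → ℝ≥0∞} (hf : ∀ n, AEMeasurable (f n) μ) :
    ρ (fun x => ∑' n, f n x) ≤ ∑' n, C ^ (n + 1) * ρ (f n) := by
  have hfinite (n : ℕ) : ∀ f : ℕ → R → ℝ≥0∞, (∀ n, AEMeasurable (f n) μ) →
      ρ (fun x => ∑ i ∈ Finset.range n, f i x) ≤
        ∑ i ∈ Finset.range n, C ^ (i + 1) * ρ (f i) := by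
    induction n with
    | zero => intro f _; simp [hρ.apply_zero]
    | succ n ih =>
      intro f hf
      simp only [Finset.sum_range_succ']
      -- The first term is split off and induction applies to the shifted sequence, so the term of
      -- index `i` collects at most `i + 1` factors `C`.
      simp only [add_comm _ (f 0 _)]
      refine (hC _ _ (hf 0) (Finset.aemeasurable_fun_sum _ fun i _ => hf _)).trans ?_
      rw [mul_add, add_comm]
      refine add_le_add ?_ (by simp)
      refine (mul_le_mul_right (ih (fun i => f (i + 1)) fun i => hf _) C).trans ?_
      rw [Finset.mul_sum]
      exact Finset.sum_le_sum fun i _ => by rw [← mul_assoc, ← pow_succ']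
  refine le_of_tendsto (hρ.p3 (fun n x => ∑ i ∈ Finset.range n, f i x) (fun x => ∑' n, f n x)
    (fun n => Finset.aemeasurable_fun_sum _ fun i _ => hf _) (.tsum hf)
    (.of_forall fun x => ⟨fun m n hmn => Finset.sum_le_sum_of_subset (Finset.range_mono hmn),
      ENNReal.summable.hasSum.tendsto_sum_nat⟩)).2 (.of_forall fun n => ?_)
  exact (hfinite n f hf).trans (ENNReal.sum_le_tsum _)

/-- If every function of finite quasinorm is integrable over `E`, then the integral over `E` is
bounded by a multiple of the quasinorm. -/
theorem exists_setLIntegral_le (hρ : IsQuasiBanachFunctionNorm μ ρ) (E : Set R)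
    (h : ∀ f : R → ℝ≥0∞, AEMeasurable f μ → ρ f < ∞ → ∫⁻ x in E, f x ∂μ < ∞) :
    ∃ C : ℝ≥0, ∀ f : R → ℝ≥0∞, AEMeasurable f μ → ∫⁻ x in E, f x ∂μ ≤ C * ρ f := by
  obtain ⟨C, hC1, hC⟩ := hρ.q1.quasi_subadditive
  by_contra! hcon
  -- The factor `C ^ (n + 1)` offsets the loss in `tsum_le`, `2 ^ (n + 1)` makes the norms summable,
  -- and `n + 1` survives to make the integral of the sum infinite.
  choose f hfm hf using fun n : ℕ => hcon ((n + 1) * (2 * C) ^ (n + 1))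
  have hC0 : C ≠ 0 := (zero_lt_one.trans_le hC1).ne'
  have hfin (n : ℕ) : ρ (f n) ≠ ∞ := by
    intro hn
    have := hf n
    rw [hn, ENNReal.mul_top (by exact_mod_cast by positivity)] at this
    exact not_top_lt this
  have hpos (n : ℕ) : ρ (f n) ≠ 0 := by
    intro hn
    have h0 := (hρ.q1.eq_zero_iff _ (hfm n)).1 hn
    have := hf n
    rw [lintegral_congr_ae (ae_restrict_of_ae h0)] at this
    simp at this
  set c : ℕ → ℝ≥0∞ := fun n => (ρ (f n) * ((2 * C) ^ (n + 1) : ℝ≥0))⁻¹ with hc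
  have hd (n : ℕ) : (((2 * C) ^ (n + 1) : ℝ≥0) : ℝ≥0∞) ≠ 0 := by
    exact_mod_cast by positivity
  have hgm (n : ℕ) : AEMeasurable (fun x => c n * f n x) μ := (hfm n).const_mul _
  have hlt : ρ (fun x => ∑' n, c n * f n x) < ∞ := by
    refine (hρ.tsum_le hC hgm).trans_lt ?_
    have : ∀ n, (C : ℝ≥0∞) ^ (n + 1) * ρ (fun x => c n * f n x) = 2⁻¹ ^ (n + 1) := by
      intro n
      have hC0' : (C : ℝ≥0∞) ^ (n + 1) ≠ 0 := pow_ne_zero _ (by exact_mod_cast hC0)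
      have hCt : (C : ℝ≥0∞) ^ (n + 1) ≠ ∞ := ENNReal.pow_ne_top ENNReal.coe_ne_top
      simp only [hρ.const_mul _ (hfm n), hc]
      rw [ENNReal.mul_inv (.inl (hpos n)) (.inl (hfin n)), mul_right_comm _ _ (ρ (f n)),
        ENNReal.inv_mul_cancel (hpos n) (hfin n), one_mul, mul_pow, ENNReal.coe_mul,
        ENNReal.mul_inv (.inr (by simp)) (.inl (by simp)), mul_left_comm, ENNReal.coe_pow C,
        ENNReal.mul_inv_cancel hC0' hCt, mul_one, ENNReal.coe_pow, ENNReal.inv_pow, ENNReal.coe_ofNat]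
    simp_rw [this]
    rw [ENNReal.tsum_geometric_add_one, ENNReal.one_sub_inv_two, inv_inv]
    exact ENNReal.mul_lt_top (by simp) (by simp)
  refine (h _ (.tsum hgm) hlt).not_ge ?_
  refine ENNReal.le_of_forall_nnreal_lt fun r _ => ?_
  obtain ⟨n, hn⟩ := exists_nat_ge r
  calc (r : ℝ≥0∞) ≤ (n + 1 : ℝ≥0) := by exact_mod_cast hn.trans (by simp)
    _ = c n * (((n + 1) * (2 * C) ^ (n + 1) : ℝ≥0) * ρ (f n)) := by
      rw [ENNReal.coe_mul, mul_assoc, mul_left_comm, mul_comm _ (ρ (f n)),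
        ENNReal.inv_mul_cancel (mul_ne_zero (hpos n) (hd n))
          (ENNReal.mul_ne_top (hfin n) ENNReal.coe_ne_top), mul_one]
    _ ≤ c n * ∫⁻ x in E, f n x ∂μ := mul_le_mul_right (hf n).le _
    _ = ∫⁻ x in E, c n * f n x ∂μ := (lintegral_const_mul'' _ (hfm n).restrict).symm
    _ ≤ _ := lintegral_mono fun x => ENNReal.le_tsum (f := fun n => c n * f n x) n

end IsQuasiBanachFunctionNorm

end FunctionNorm

/-! ### Rearrangement-invariant norms on the half-line -/

theorem lebesgueNorm_one (f : ℝ≥0 → ℝ≥0∞) : lebesgueNorm 1 f = ∫⁻ t, f t ∂halfLine := by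
  simp [lebesgueNorm, eLpNorm_one_eq_lintegral_enorm]

theorem lebesgueNorm_one_indicator {E : Set ℝ≥0} (hE : MeasurableSet E) (f : ℝ≥0 → ℝ≥0∞) :
    lebesgueNorm 1 (E.indicator f) = ∫⁻ t in E, f t ∂halfLine := by
  rw [lebesgueNorm_one, lintegral_indicator hE]

theorem ae_le_lebesgueNorm_top (f : ℝ≥0 → ℝ≥0∞) :
    ∀ᵐ t ∂halfLine, f t ≤ lebesgueNorm ∞ f := by
  rw [lebesgueNorm, eLpNorm_exponent_top]
  exact ae_le_eLpNormEssSup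

theorem lebesgueNorm_top_le {f : ℝ≥0 → ℝ≥0∞} {c : ℝ≥0∞} (h : ∀ t, f t ≤ c) :
    lebesgueNorm ∞ f ≤ c := by
  rw [lebesgueNorm, eLpNorm_exponent_top]
  exact essSup_le_of_ae_le _ (.of_forall h)

/-- The sum of the values of the rearrangement at the integers `≥ 2` is at most its integral over
`(1, ∞)`. -/
theorem tsum_rearrangement_le (f : ℝ≥0 → ℝ≥0∞) :
    ∑' n : ℕ, rearrangement halfLine f (n + 2) ≤
      ∫⁻ t in Ioi 1, rearrangement halfLine f t ∂halfLine := by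
  have hu : Monotone fun n : ℕ => (n : ℝ≥0) + 1 := fun m n h => by
    simpa using h
  have hd := hu.pairwise_disjoint_on_Ioc_succ
  calc ∑' n : ℕ, rearrangement halfLine f (n + 2)
      ≤ ∑' n : ℕ, ∫⁻ t in Ioc ((n : ℝ≥0) + 1) ((Order.succ n : ℕ) + 1),
          rearrangement halfLine f t ∂halfLine := by
        refine ENNReal.tsum_le_tsum fun n => ?_
        have hs : ((Order.succ n : ℕ) : ℝ≥0) + 1 = n + 2 := by
          rw [Order.succ_eq_add_one]; push_cast; ring
        have hle := setLIntegral_mono' (μ := halfLine)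
          (f := fun _ => rearrangement halfLine f (n + 2)) (g := rearrangement halfLine f)
          (measurableSet_Ioc (a := (n : ℝ≥0) + 1) (b := n + 2))
          fun t ht => rearrangement_antitone halfLine f ht.2
        have hone : (n : ℝ≥0) + 2 - (n + 1) = 1 := by
          rw [add_tsub_add_eq_tsub_left]; exact tsub_eq_of_eq_add (by norm_num)
        rw [hs]
        simpa [halfLine_Ioc, hone] using hle
    _ = ∫⁻ t in ⋃ n : ℕ, Ioc ((n : ℝ≥0) + 1) ((Order.succ n : ℕ) + 1),
          rearrangement halfLine f t ∂halfLine :=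
        (lintegral_iUnion (fun _ => measurableSet_Ioc) hd _).symm
    _ ≤ _ := lintegral_mono_set (iUnion_subset fun n t ht => lt_of_le_of_lt (by simp) ht.1)

namespace IsRIQuasiBanachFunctionNorm

variable {A : (ℝ≥0 → ℝ≥0∞) → ℝ≥0∞}

theorem apply_rearrangement (hA : IsRIQuasiBanachFunctionNorm halfLine A) {f : ℝ≥0 → ℝ≥0∞}
    (hf : AEMeasurable f halfLine) : A (rearrangement halfLine f) = A f :=
  hA.rearrangement_invariant _ _ (measurable_rearrangement _ f).aemeasurable hf
    (distribution_rearrangement _ f)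

theorem indicator_rearrangement_le (hA : IsRIQuasiBanachFunctionNorm halfLine A)
    {f : ℝ≥0 → ℝ≥0∞} (hf : AEMeasurable f halfLine) {E : Set ℝ≥0} (hE : MeasurableSet E) :
    A (E.indicator (rearrangement halfLine f)) ≤ A f := by
  have hm := measurable_rearrangement halfLine f
  rw [← hA.apply_rearrangement hf]
  exact hA.p2 _ _ (hm.indicator hE).aemeasurable hm.aemeasurable
    (.of_forall (indicator_le_self _ _))

theorem indicator_one_eq_of_measure_eq (hA : IsRIQuasiBanachFunctionNorm halfLine A)
    {E F : Set ℝ≥0} (hE : MeasurableSet E) (hF : MeasurableSet F)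
    (h : halfLine E = halfLine F) :
    A (E.indicator fun _ => 1) = A (F.indicator fun _ => 1) := by
  refine hA.rearrangement_invariant _ _ (measurable_const.indicator hE).aemeasurable
    (measurable_const.indicator hF).aemeasurable ?_
  funext s
  rw [distribution_indicator_one, distribution_indicator_one, h]

theorem indicator_Icc_ne_zero (hA : IsRIQuasiBanachFunctionNorm halfLine A) :
    A ((Icc 0 1).indicator fun _ => 1) ≠ 0 := by
  intro h
  have h0 := (hA.q1.eq_zero_iff _ (measurable_const.indicator measurableSet_Icc).aemeasurable).1 h
  have hnull : halfLine (Icc 0 1) = 0 := by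
    refine measure_mono_null (fun t ht => ?_) (ae_iff.1 h0)
    simpa using ht.2
  simp [halfLine_Icc_zero] at hnull

theorem indicator_Icc_ne_top (hA : IsRIQuasiBanachFunctionNorm halfLine A) :
    A ((Icc 0 1).indicator fun _ => 1) ≠ ∞ := by
  refine (hA.p4 _ measurableSet_Icc ?_).ne
  simp [halfLine_Icc_zero]

/-- Chebyshev-type estimate for the rearrangement. -/
theorem rearrangement_one_mul_le (hA : IsRIQuasiBanachFunctionNorm halfLine A)
    (f : ℝ≥0 → ℝ≥0∞) :
    rearrangement halfLine f 1 * A ((Icc 0 1).indicator fun _ => 1) ≤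
      A ((Icc 0 1).indicator (rearrangement halfLine f)) := by
  have hχ : Measurable ((Icc (0 : ℝ≥0) 1).indicator fun _ => (1 : ℝ≥0∞)) :=
    measurable_const.indicator measurableSet_Icc
  rw [← hA.const_mul _ hχ.aemeasurable]
  refine hA.p2 _ _ (hχ.const_mul _).aemeasurable
    ((measurable_rearrangement _ f).indicator measurableSet_Icc).aemeasurable
    (.of_forall fun t => ?_)
  by_cases ht : t ∈ Icc (0 : ℝ≥0) 1
  · simpa [indicator_of_mem ht] using rearrangement_antitone halfLine f ht.2
  · simp [indicator_of_notMem ht]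

/-- Left-endpoint values give a step function above the tail, with all steps of norm `a` times their
height. Shifted by one step, these values are right-endpoint values and lie below the integral; only
the first, `f^*(1)`, is left over, and the head controls it. -/
theorem indicator_Ioi_rearrangement_le (hA : IsRIQuasiBanachFunctionNorm halfLine A)
    (h1 : HasP1 halfLine A) (f : ℝ≥0 → ℝ≥0∞) :
    A ((Ioi 1).indicator (rearrangement halfLine f)) ≤
      A ((Icc 0 1).indicator (rearrangement halfLine f)) +
        A ((Icc 0 1).indicator fun _ => 1) *
          ∫⁻ t in Ioi 1, rearrangement halfLine f t ∂halfLine := by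
  set a := A ((Icc 0 1).indicator fun _ => 1)
  set χ : ℕ → ℝ≥0 → ℝ≥0∞ := fun n => (Ioc ((n : ℝ≥0) + 1) (n + 2)).indicator fun _ => 1 with hχ
  have hχm (n : ℕ) : Measurable (χ n) := measurable_const.indicator measurableSet_Ioc
  have hχa (n : ℕ) : A (χ n) = a := by
    refine hA.indicator_one_eq_of_measure_eq measurableSet_Ioc measurableSet_Icc ?_
    have hone : (n : ℝ≥0) + 2 - (n + 1) = 1 := by
      rw [add_tsub_add_eq_tsub_left]; exact tsub_eq_of_eq_add (by norm_num)
    rw [halfLine_Ioc, halfLine_Icc_zero, hone]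
  have hm (n : ℕ) : AEMeasurable (fun t => rearrangement halfLine f (n + 1) * χ n t) halfLine :=
    ((hχm n).const_mul _).aemeasurable
  calc A ((Ioi 1).indicator (rearrangement halfLine f))
      ≤ A (fun t => ∑' n : ℕ, rearrangement halfLine f (n + 1) * χ n t) := by
        refine hA.p2 _ _ ((measurable_rearrangement _ f).indicator measurableSet_Ioi).aemeasurable
          (.tsum hm) (.of_forall fun t => ?_)
        refine indicator_le (g := fun t => ∑' n : ℕ, rearrangement halfLine f (n + 1) * χ n t)
          (fun t (ht : 1 < t) => ?_) t
        obtain ⟨n, hn⟩ : ∃ n : ℕ, ⌈t⌉₊ = n + 2 := by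
          have : 1 < ⌈t⌉₊ := Nat.lt_ceil.2 (by simpa using ht)
          exact ⟨⌈t⌉₊ - 2, by omega⟩
        have hlo : (n : ℝ≥0) + 1 < t := by
          have := Nat.lt_ceil.1 (show n + 1 < ⌈t⌉₊ by omega)
          exact_mod_cast this
        have hhi : t ≤ (n : ℝ≥0) + 2 := by
          have := Nat.le_ceil t
          rw [hn] at this
          exact_mod_cast this
        refine le_trans ?_ (ENNReal.le_tsum n)
        simp only [hχ]
        rw [indicator_of_mem (show t ∈ Ioc ((n : ℝ≥0) + 1) (n + 2) from ⟨hlo, hhi⟩), mul_one]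
        exact rearrangement_antitone _ f hlo.le
    _ ≤ ∑' n : ℕ, rearrangement halfLine f (n + 1) * a := by
        refine (hA.tsum_le (C := 1) (fun f g hf hg => ?_) hm).trans_eq ?_
        · rw [one_mul]; exact h1.subadditive f g hf hg
        · refine tsum_congr fun n => ?_
          rw [one_pow, one_mul, hA.const_mul _ (hχm n).aemeasurable, hχa]
    _ = rearrangement halfLine f 1 * a + a * ∑' n : ℕ, rearrangement halfLine f (n + 2) := by
        rw [tsum_eq_zero_add' ENNReal.summable, ENNReal.tsum_mul_right, mul_comm a]
        congr 3
        · simp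
        · funext n; congr 1; push_cast; ring
    _ ≤ _ := add_le_add (hA.rearrangement_one_mul_le f)
        (mul_le_mul_right (tsum_rearrangement_le f) _)

/-! ### Embeddings of Wiener--Luxemburg amalgams -/

theorem le_mul_indicator_rearrangement_add (hA : IsRIQuasiBanachFunctionNorm halfLine A) {C : ℝ≥0∞}
    (hC : ∀ f g : ℝ≥0 → ℝ≥0∞, AEMeasurable f halfLine → AEMeasurable g halfLine →
      A (fun x => f x + g x) ≤ C * (A f + A g))
    {f : ℝ≥0 → ℝ≥0∞} (hf : AEMeasurable f halfLine) :
    A f ≤ C * (A ((Icc 0 1).indicator (rearrangement halfLine f)) +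
      A ((Ioi 1).indicator (rearrangement halfLine f))) := by
  have hm := measurable_rearrangement halfLine f
  rw [← hA.apply_rearrangement hf]
  refine le_trans (le_of_eq ?_) (hC _ _ (hm.indicator measurableSet_Icc).aemeasurable
    (hm.indicator measurableSet_Ioi).aemeasurable)
  congr 1
  funext t
  rcases le_or_gt t 1 with ht | ht
  · simp [indicator, ht, ht.not_gt]
  · simp [indicator, ht, ht.not_ge]

theorem WL_top_embeds (hA : IsRIQuasiBanachFunctionNorm halfLine A) :
    Embeds halfLine (WL (lebesgueNorm ∞) A) A := by
  obtain ⟨C, -, hC⟩ := hA.q1.quasi_subadditive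
  obtain ⟨a, ha⟩ : ∃ a : ℝ≥0, (a : ℝ≥0∞) = A ((Icc 0 1).indicator fun _ => 1) :=
    ⟨_, ENNReal.coe_toNNReal hA.indicator_Icc_ne_top⟩
  refine Embeds.of_le (C * (a + 1)) fun f hf _ => ?_
  have hm := (measurable_rearrangement halfLine f).indicator (measurableSet_Icc (a := 0) (b := 1))
  have hχ : Measurable ((Icc (0 : ℝ≥0) 1).indicator fun _ => (1 : ℝ≥0∞)) :=
    measurable_const.indicator measurableSet_Icc
  have h1 : A ((Icc 0 1).indicator (rearrangement halfLine f)) ≤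
      lebesgueNorm ∞ ((Icc 0 1).indicator (rearrangement halfLine f)) * a := by
    rw [ha, ← hA.const_mul _ hχ.aemeasurable]
    refine hA.p2 _ _ hm.aemeasurable (hχ.const_mul _).aemeasurable ?_
    filter_upwards [ae_le_lebesgueNorm_top ((Icc 0 1).indicator (rearrangement halfLine f))]
      with t ht
    by_cases htm : t ∈ Icc (0 : ℝ≥0) 1
    · simpa only [indicator_of_mem htm, mul_one] using ht
    · simp [indicator_of_notMem htm]
  refine (hA.le_mul_indicator_rearrangement_add hC hf).trans ?_
  rw [ENNReal.coe_mul, mul_assoc]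
  refine mul_le_mul_right ?_ _
  rw [WL, mul_add, mul_comm _ (lebesgueNorm _ _)]
  refine add_le_add (h1.trans (mul_le_mul_right (by simp) _)) ?_
  exact le_mul_of_one_le_left' (by simp)

theorem WL_one_embeds (hA : IsRIQuasiBanachFunctionNorm halfLine A) (h1 : HasP1 halfLine A) :
    Embeds halfLine (WL A (lebesgueNorm 1)) A := by
  obtain ⟨a, ha⟩ : ∃ a : ℝ≥0, (a : ℝ≥0∞) = A ((Icc 0 1).indicator fun _ => 1) :=
    ⟨_, ENNReal.coe_toNNReal hA.indicator_Icc_ne_top⟩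
  -- The head counts twice: once from the splitting of `f^*`, once from bounding `f^*(1) * a`.
  refine Embeds.of_le (a + 2) fun f hf _ => ?_
  have h := hA.le_mul_indicator_rearrangement_add (C := 1)
    (fun f g hf hg => by rw [one_mul]; exact h1.subadditive f g hf hg) hf
  rw [one_mul] at h
  refine (h.trans (add_le_add le_rfl (hA.indicator_Ioi_rearrangement_le h1 f))).trans ?_
  rw [WL, lebesgueNorm_one_indicator measurableSet_Ioi, ← ha, mul_add, ← add_assoc, ← two_mul]
  refine add_le_add (mul_le_mul_left ?_ _) (mul_le_mul_left ?_ _) <;> simp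

theorem embeds_WL_top (hA : IsRIQuasiBanachFunctionNorm halfLine A) :
    Embeds halfLine A (WL A (lebesgueNorm ∞)) := by
  have ha0 := hA.indicator_Icc_ne_zero
  have hat := hA.indicator_Icc_ne_top
  obtain ⟨b, hb⟩ : ∃ b : ℝ≥0, (b : ℝ≥0∞) = (A ((Icc 0 1).indicator fun _ => 1))⁻¹ :=
    ⟨_, ENNReal.coe_toNNReal (ENNReal.inv_ne_top.2 ha0)⟩
  refine Embeds.of_le (1 + b) fun f hf _ => ?_
  have h1 := hA.indicator_rearrangement_le hf (measurableSet_Icc (a := 0) (b := 1))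
  rw [WL, ENNReal.coe_add, add_mul, ENNReal.coe_one, one_mul]
  refine add_le_add h1 ((lebesgueNorm_top_le (c := rearrangement halfLine f 1) fun t =>
    indicator_le (fun t ht => rearrangement_antitone _ f (le_of_lt ht)) t).trans ?_)
  rw [hb, mul_comm, ← div_eq_mul_inv, ENNReal.le_div_iff_mul_le (.inl ha0) (.inl hat)]
  exact (hA.rearrangement_one_mul_le f).trans h1

theorem embeds_WL_one (hA : IsRIQuasiBanachFunctionNorm halfLine A) (h5 : HasP5 halfLine A) :
    Embeds halfLine A (WL (lebesgueNorm 1) A) := by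
  obtain ⟨C, hC⟩ := h5 (Icc 0 1) measurableSet_Icc (by simp [halfLine_Icc_zero])
  refine Embeds.of_le (C + 1) fun f hf _ => ?_
  rw [WL, lebesgueNorm_one_indicator measurableSet_Icc, ENNReal.coe_add, add_mul,
    ENNReal.coe_one, one_mul]
  refine add_le_add ?_ (hA.indicator_rearrangement_le hf measurableSet_Ioi)
  -- (P5) is applied to `f^*` itself; rearrangement invariance returns to `f`.
  refine (hC _ (measurable_rearrangement _ f).aemeasurable).trans_eq ?_
  rw [hA.apply_rearrangement hf]

theorem hasP5_of_functionSpace_subset (hA : IsRIQuasiBanachFunctionNorm halfLine A)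
    (h : functionSpace halfLine A ⊆ functionSpace halfLine (WL (lebesgueNorm 1) A)) :
    HasP5 halfLine A := by
  refine fun E hE hμE => hA.exists_setLIntegral_le E fun f hf hfin => ?_
  have hlt := hA.ae_lt_top hf hfin
  -- The spaces consist of complex-valued classes, so `f`, finite almost everywhere, is represented
  -- by its real values.
  have hgm : AEStronglyMeasurable (fun t => ((f t).toReal : ℂ)) halfLine :=
    (Complex.measurable_ofReal.comp_aemeasurable hf.ennreal_toReal).aestronglyMeasurable
  set g : ℝ≥0 →ₘ[halfLine] ℂ := AEEqFun.mk _ hgm with hg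
  have hgf : (fun t => ‖g t‖ₑ) =ᵐ[halfLine] f := by
    filter_upwards [AEEqFun.coeFn_mk _ hgm, hlt] with t ht htf
    rw [hg, ht, ← ofReal_norm, Complex.norm_real, Real.norm_of_nonneg ENNReal.toReal_nonneg,
      ENNReal.ofReal_toReal htf.ne]
  have hgm' : AEMeasurable (fun t => ‖g t‖ₑ) halfLine := g.aestronglyMeasurable.enorm
  have hgA : g ∈ functionSpace halfLine A := by
    change A _ < ∞
    rwa [hA.p2.congr hgm' hf hgf]
  have hW : WL (lebesgueNorm 1) A (fun t => ‖g t‖ₑ) < ∞ := h hgA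
  rw [WL, lebesgueNorm_one_indicator measurableSet_Icc] at hW
  rw [← lintegral_congr_ae (ae_restrict_of_ae hgf)]
  refine (setLIntegral_le_setLIntegral_rearrangement hgm' hE hμE.ne).trans_lt ?_
  exact ENNReal.mul_lt_top (max_lt ENNReal.one_lt_top hμE) (le_self_add.trans_lt hW)

end IsRIQuasiBanachFunctionNorm

end WienerLuxemburg

theorem mainTheorem10 (A : (ℝ≥0 → ℝ≥0∞) → ℝ≥0∞)
    (hA : IsRIQuasiBanachFunctionNorm halfLine A) :
    Embeds halfLine (WL (lebesgueNorm ∞) A) A ∧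
    (HasP1 halfLine A → Embeds halfLine (WL A (lebesgueNorm 1)) A) ∧
    (Embeds halfLine A (WL (lebesgueNorm 1) A) ↔ HasP5 halfLine A) ∧
    Embeds halfLine A (WL A (lebesgueNorm ∞)) :=
  ⟨hA.WL_top_embeds, hA.WL_one_embeds,
    ⟨fun h => hA.hasP5_of_functionSpace_subset h.choose, hA.embeds_WL_one⟩, hA.embeds_WL_top⟩
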